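/- **Setting.** Let $n,m,a,c,b,z$ be natural numbers with $c<a$ and $b<a$. The zig-zag network has a source $s$, intermediate nodes $A,B$ and a sink $u$; there are $n$ upstream links $s\to A$ of capacity $a$, $m$ downstream links $B\to u$ of capacity $c$, a feedback link $A\to B$ of capacity $b$, and reliable links of unbounded capacity $s\to B$ and $A\to u$. An adversary may add arbitrary errors on at most $z$ of the $n+m$ forward (upstream and downstream) links; the feedback link is error-free. Suppose that the tight conditions hold: $b<\min\{z(a-c),\,zc-(z-2)a\}$ if $n\ge 2(z-1)$, $m\ge 2z$; $b<\min\{z(a-c),\,(n-z+2)c-(n-z)a\}$ if $z\le n<2(z-1)$, $m\ge 2z$; $b<\min\{zc-(z-2)a,\,(m-z)(a-c)\}$ if $n\ge 2(z-1)$, $m<2z$; $b<\min\{(n-z+2)c-(n-z)a,\,(m-z)(a-c)\}$ if $z\le n<2(z-1)$, $m<2z$. **Codes.** A message over $GF(q)$ is encoded into the $a\times(n+m)$ matrix $\begin{pmatrix}X&0\\Y&L\end{pmatrix}$, whose first $n$ columns are sent on the upstream links and whose last $m$ columns are sent on the downstream links (bottom $c$ entries only). Row $l$ of the $(a-c)\times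 n$ block $X$ encodes $n-z+k'_l$ message symbols by a systematic MDS code of length $n$, where $\sum_l k'_l=b$, $k'_{a-c}=z-1$ and $k'_l\in\{0,z\}$ for $l<a-c$; the $c\times(n+m-2z)$ block $Y$ consists of further message symbols; the entries of the $c\times 2z$ block $L$ are linear combinations of all message symbols in general position, i.e. the rank of any set of entries of $X,Y,L$ is the minimum of the number of message symbols and the rank of its $X,Y$-part plus the number of its entries in $L$. The number of message symbols is then $(n-z)a+(m-z)c+b$. **Theorem.** Suppose that either $b=z(a-c)-1$ and $z>2$, or $b$ is odd, $b<z(a-c)-1$ and $z=2$. Then for every sufficiently large $q$ (depending only on $n,m,a,c,b,z$) there is a code as above over $GF(q)$ such that, for each upstream link $i$, once link $i$ has been identified as erroneous, there is a signaling strategy with the following properties. For each row $l$ of the received block $\hat X$, node $A$ sends $k'_l$ linear combinations of the entries of that row on the feedback link ($b$ symbols in total), and in addition it may decide, from $\hat X$, to call for a claim; node $B$ sends a claim message if $A$ calls for one or if $B$, knowing the message and the feedback symbols, decides to do so. 1. No claim is sent if the received entries of $X$ on the upstream links other than $i$ are all correct. 2. In every transmission with at most $z$ erroneous forward links, $i$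 counted among them, in which no claim is sent, the sink decodes correctly by exhaustive search: it trusts a fixed set of received entries of $X$ (depending only on the code and $i$), which contains, on the links other than $i$, at least the rows $l<a-c$ and the entries in columns $n-z+1,\dots,n-1$ of the last row; it goes, in any order, through the sets $R$ of $z-1$ forward links other than $i$ and checks whether the symbols on the links outside $R\cup\{i\}$ together with the trusted symbols are consistent with a codeword. Some $R$ passes the check, and whenever some $R$ passes it, the only message consistent with these symbols is the message that was sent. So the decoder that stops at the first consistent removal set outputs the message that was sent. -/

import Mathlib

/-- The tight conditions of the zig-zag network with `n` upstream links of capacity `a`,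
`m` downstream links of capacity `c`, a feedback link of capacity `b` and `z` adversarial links,
in the four categories given by the sizes of `n` and `m`. -/
def TightConditions (n m a c b z : ℤ) : Prop :=
  (2 * (z - 1) ≤ n ∧ 2 * z ≤ m ∧ b < min (z * (a - c)) (z * c - (z - 2) * a)) ∨
  (z ≤ n ∧ n < 2 * (z - 1) ∧ 2 * z ≤ m ∧
    b < min (z * (a - c)) ((n - z + 2) * c - (n - z) * a)) ∨
  (2 * (z - 1) ≤ n ∧ m < 2 * z ∧ b < min (z * c - (z - 2) * a) ((m - z) * (a - c))) ∨
  (z ≤ n ∧ n < 2 * (z - 1) ∧ m < 2 * z ∧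
    b < min ((n - z + 2) * c - (n - z) * a) ((m - z) * (a - c)))

open Classical in
/-- The `k × n` matrix `G` generates a maximum distance separable code of dimension `k`: every
codeword of a nonzero vector has weight at least `n - k + 1`. -/
def IsMDSGenerator {K : Type*} [Field K] {k n : ℕ} (G : Matrix (Fin k) (Fin n) K) : Prop :=
  ∀ u : Fin k → K, u ≠ 0 → n + 1 ≤ k + hammingNorm (Matrix.vecMul u G)

/-- The forward links: `Sum.inl j` is the `j`-th upstream link (source to node `A`),
`Sum.inr j` is the `j`-th downstream link (node `B` to sink). -/
abbrev Link (n m : ℕ) : Type := Fin n ⊕ Fin m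

/-- The column of the `a × (n + m)` codeword matrix that is sent on a forward link. -/
def Link.col {n m : ℕ} : Link n m → ℕ
  | Sum.inl j => j
  | Sum.inr j => n + j

theorem Link.col_lt {n m : ℕ} (t : Link n m) : t.col < n + m := by
  rcases t with j | j
  · have := j.2
    simp only [Link.col]
    omega
  · have := j.2
    simp only [Link.col]
    omega

/-- The coefficients of the linear code with codeword matrix `[[X, 0], [Y, L]]`: row `l` of the
`(a - c) × n` block `X` encodes `n - z + k' l` message symbols with the generator matrix `G l`;
the `c × (n + m - 2z)` block `Y` consists of message symbols; the entry `(r, s)` of the `c × 2z`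
block `L` is the linear combination of all message symbols with coefficients `L r s`. -/
structure ZigZagCode (K : Type*) [Field K] (n m a c z : ℕ) where
  k' : Fin (a - c) → ℕ
  G : ∀ l : Fin (a - c), Matrix (Fin (n - z + k' l)) (Fin n) K
  L : Fin c → Fin (2 * z) →
    ((Σ l : Fin (a - c), Fin (n - z + k' l)) ⊕ (Fin c × Fin (n + m - 2 * z))) → K

namespace ZigZagCode

variable {K : Type*} [Field K] {n m a c z : ℕ}

/-- Index set of the message symbols: the symbols `x_{l,j}` and the symbols `y_{r,j}`. -/
abbrev MsgIdx (C : ZigZagCode K n m a c z) : Type :=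
  (Σ l : Fin (a - c), Fin (n - z + C.k' l)) ⊕ (Fin c × Fin (n + m - 2 * z))

/-- A source message. -/
abbrev Msg (C : ZigZagCode K n m a c z) : Type _ := C.MsgIdx → K

/-- Coefficient vector of the entry `(l, j)` of `X`. -/
def xVec (C : ZigZagCode K n m a c z) (p : Fin (a - c) × Fin n) : C.MsgIdx → K
  | Sum.inl q => if q.1 = p.1 then C.G q.1 q.2 p.2 else 0
  | Sum.inr _ => 0

/-- Coefficient vector of the entry `(r, j)` of `Y`. -/
def yVec (C : ZigZagCode K n m a c z) (p : Fin c × Fin (n + m - 2 * z)) : C.MsgIdx → K :=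
  Pi.single (Sum.inr p) 1

/-- Coefficient vector of the symbol of row `r` of the block `(Y L)` sent on the link `t`. -/
def lowerVec (C : ZigZagCode K n m a c z) (r : Fin c) (t : Link n m) : C.MsgIdx → K :=
  if h : t.col < n + m - 2 * z then C.yVec (r, ⟨t.col, h⟩)
  else C.L r ⟨t.col - (n + m - 2 * z), by have := t.col_lt; omega⟩

/-- The entries of `L` are in general position with respect to those of `X` and `Y`: any set of
code symbols is maximally independent, up to the dependencies inside the rows of `X`. -/
def IsGeneric (C : ZigZagCode K n m a c z) : Prop :=
  ∀ (P : Set (Fin (a - c) × Fin n)) (Q : Set (Fin c × Fin (n + m - 2 * z)))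
    (R : Finset (Fin c × Fin (2 * z))),
    Module.finrank K (Submodule.span K
        (C.xVec '' P ∪ C.yVec '' Q ∪ (fun s => C.L s.1 s.2) '' (R : Set (Fin c × Fin (2 * z))))) =
      min (Fintype.card C.MsgIdx)
        (Module.finrank K (Submodule.span K (C.xVec '' P ∪ C.yVec '' Q)) + R.card)

/-- The code is one of the encoding scheme, for feedback capacity `b`: the rows of `X` are encoded
by systematic MDS codes, with `k' l ≤ z` feedback symbols `v` in row `l` and `b` in total; the
last row has `k' = z - 1` (one redundant symbol), each other row has `k' = z` (no redundant symbol)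
or `k' = 0` (`z` redundant symbols); and the entries of `L` are in general position. -/
structure IsAdmissible (C : ZigZagCode K n m a c z) (b : ℕ) : Prop where
  sum_k' : ∑ l, C.k' l = b
  k'_last : ∀ l : Fin (a - c), (l : ℕ) + 1 = a - c → C.k' l = z - 1
  k'_other : ∀ l : Fin (a - c), (l : ℕ) + 1 < a - c → C.k' l = 0 ∨ C.k' l = z
  systematic : ∀ (l : Fin (a - c)) (s : Fin (n - z + C.k' l)) (j : Fin n),
    (j : ℕ) < n - z + C.k' l → C.G l s j = if (s : ℕ) = j then 1 else 0
  mds : ∀ l : Fin (a - c), IsMDSGenerator (C.G l)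
  generic : C.IsGeneric

/-- The symbols that travel on (or are injected in) the forward links in one transmission: the
first component holds the first `a - c` symbols of each upstream link, the second one the last
`c` symbols of each upstream link and the `c` symbols of each downstream link. -/
abbrev Word (_C : ZigZagCode K n m a c z) : Type _ :=
  Matrix (Fin (a - c)) (Fin n) K × Matrix (Fin c) (Link n m) K

/-- The codeword of a message. -/
def encode (C : ZigZagCode K n m a c z) (μ : C.Msg) : C.Word :=
  (Matrix.of fun l j => C.xVec (l, j) ⬝ᵥ μ, Matrix.of fun r t => C.lowerVec r t ⬝ᵥ μ)

/-- The error `e` is injected in links of `Z` only. -/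
def SupportedOn (C : ZigZagCode K n m a c z) (e : C.Word) (Z : Finset (Link n m)) : Prop :=
  (∀ l j, Sum.inl j ∉ Z → e.1 l j = 0) ∧ (∀ r t, t ∉ Z → e.2 r t = 0)

/-- How nodes `A` and `B` cooperate. For each row `l` of the received block `X`, node `A` sends
`k' l` linear combinations of its entries, with coefficients `θ l`, on the feedback link;
`signalA` is its decision to send the claim-sending signal, which depends only on the received
block `X`. `detectB` is the decision of node `B`, which depends only on the message and on the
feedback symbols. -/
structure Signaling (C : ZigZagCode K n m a c z) where
  θ : ∀ l : Fin (a - c), Matrix (Fin n) (Fin (C.k' l)) K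
  signalA : Matrix (Fin (a - c)) (Fin n) K → Prop
  detectB : C.Msg → (∀ l : Fin (a - c), Fin (C.k' l) → K) → Prop

/-- The symbols on the (reliable) feedback link, when node `A` has received `X`. -/
def Signaling.feedback {C : ZigZagCode K n m a c z} (S : C.Signaling)
    (X : Matrix (Fin (a - c)) (Fin n) K) (l : Fin (a - c)) : Fin (C.k' l) → K :=
  Matrix.vecMul (X l) (S.θ l)

/-- Node `B` sends the claim message, when the message is `μ` and node `A` has received `X`. -/
def Signaling.Claims {C : ZigZagCode K n m a c z} (S : C.Signaling) (μ : C.Msg)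
    (X : Matrix (Fin (a - c)) (Fin n) K) : Prop :=
  S.signalA X ∨ S.detectB μ (S.feedback X)

/-- The entries of `X` outside the upstream link `i` that lie in a row other than the last one, or
that are one of the symbols `v` of the last row. -/
def core (C : ZigZagCode K n m a c z) (i : Fin n) : Set (Fin (a - c) × Fin n) :=
  {p | p.2 ≠ i ∧ ((p.1 : ℕ) + 1 < a - c ∨
    (n - z ≤ (p.2 : ℕ) ∧ (p.2 : ℕ) < n - z + C.k' p.1))}

/-- The candidates for removal: the sets of `z - 1` forward links other than the identified
link `i`. -/
def IsRemovalSet (z : ℕ) {n m : ℕ} (i : Fin n) (R : Finset (Link n m)) : Prop :=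
  Sum.inl i ∉ R ∧ R.card = z - 1

/-- After removal of `R` and of the identified link `i`, the remaining symbols of the received word
`w`, together with the entries of `X` in the set `T` of trusted positions, are those of the
codeword of `μ`. -/
def ConsistentWith (C : ZigZagCode K n m a c z) (i : Fin n) (T : Set (Fin (a - c) × Fin n))
    (w : C.Word) (R : Finset (Link n m)) (μ : C.Msg) : Prop :=
  (∀ l j, (l, j) ∈ T → w.1 l j = (C.encode μ).1 l j) ∧
  (∀ l j, j ≠ i → Sum.inl j ∉ R → w.1 l j = (C.encode μ).1 l j) ∧
  (∀ r t, t ≠ Sum.inl i → t ∉ R → w.2 r t = (C.encode μ).2 r t)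

open Classical in
/-- The exhaustive search decoder of the sink: it goes through the removal sets of the list `o` in
turn until the remaining symbols are consistent, and outputs a message they come from. -/
noncomputable def searchDecode (C : ZigZagCode K n m a c z) (i : Fin n)
    (T : Set (Fin (a - c) × Fin n)) (o : List (Finset (Link n m))) (w : C.Word) :
    Option C.Msg :=
  o.findSome? fun R =>
    if h : ∃ μ, C.ConsistentWith i T w R μ then some h.choose else none

end ZigZagCode

/-! Both nodes ignore link `i`, so that at most `z - 1` other links carry errors. In a row with `k'
l ≥ z - 1` the feedback consists of power sums of the entries off `i`; an error with at most `z - 1`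
nonzero entries and `z - 1` vanishing power sums is zero. A row with `k' l = 0` lies in a code of
distance at least `z + 1`; a codeword that matches the received row off `i` differs from the sent
one on at most `z` links, `i` included, hence equals it. So silence certifies every entry of `X` off
`i`, and all of these may be trusted (`error_eq_zero_of_not_claims`).

Uniqueness is then a dimension count (`eq_zero_of_symbols_eq_zero`). A consistent message and the
sent one agree on `X` off `i` and on the lower symbols off `Z ∪ R`, which has at most `2z - 1`
links. Losing column `i` of `X` costs one dimension in each of the `h` rows with `k' l = z` and
nothing elsewhere; the tight conditions give `h ≤ c` (`TightConditions.bounds`). If the lost links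
meet `p` columns of `Y` and `q` of `L`, then `p + q ≤ 2z - 1`, so the `c(2z - q)` remaining generic
entries of `L` make up for the at most `c + cp` missing dimensions. -/

/-! ### General position over a finite field. -/

open Module in
/-- A vector space over a finite field is not covered by at most as few proper subspaces as the
field has elements. -/
theorem Submodule.exists_forall_notMem_of_card_lt {K V κ : Type*} [Field K] [Fintype K]
    [AddCommGroup V] [Module K V] [FiniteDimensional K V] [Fintype κ]
    (W : κ → Submodule K V) (hcard : Fintype.card κ < Fintype.card K) :
    ∃ v : V, ∀ k, W k ≠ ⊤ → v ∉ W k := by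
  classical
  by_contra! hcover
  have : Finite V := Module.finite_of_finite K
  have := Fintype.ofFinite V
  have hq : 0 < Fintype.card K := Fintype.card_pos
  rcases Nat.eq_zero_or_pos (finrank K V) with h0 | hpos
  · obtain ⟨k, hk, -⟩ := hcover 0
    exact hk (Submodule.eq_top_of_finrank_eq (by have := Submodule.finrank_le (W k); omega))
  have hsub : (Finset.univ : Finset V) ⊆
      (Finset.univ.filter fun k => W k ≠ ⊤).biUnion fun k => Finset.univ.filter (· ∈ W k) := by
    intro v _
    obtain ⟨k, hk, hv⟩ := hcover v
    simp only [Finset.mem_biUnion, Finset.mem_filter, Finset.mem_univ, true_and]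
    exact ⟨k, hk, hv⟩
  -- With `d` the dimension, a proper subspace has at most `q ^ (d - 1)` vectors, so fewer than `q`
  -- of them cannot exhaust `q ^ d`.
  have hle := (Finset.card_le_card hsub).trans (Finset.card_biUnion_le_card_mul _ _
    (Fintype.card K ^ (finrank K V - 1)) fun k hk => by
      have hlt := Submodule.finrank_lt (Finset.mem_filter.1 hk).2
      rw [← Fintype.card_subtype, Module.card_eq_pow_finrank (K := K) (V := W k)]
      exact Nat.pow_le_pow_right hq (by omega))
  rw [Finset.card_univ, Module.card_eq_pow_finrank (K := K) (V := V)] at hle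
  have h1 : (Finset.univ.filter fun k => W k ≠ ⊤).card < Fintype.card K :=
    (Finset.card_le_univ _).trans_lt hcard
  have h2 := Nat.mul_lt_mul_of_pos_right h1 (pow_pos hq (finrank K V - 1))
  rw [← pow_succ', Nat.sub_add_cancel hpos] at h2
  omega

-- The vectors are chosen greedily: each new one avoids every proper subspace spanned by some `U k`
-- and some of the earlier vectors, so it adds a dimension wherever one is left to add. Indexing
-- these subspaces by `κ × Finset ι` gives one cardinality bound for all steps.
open Module in
theorem exists_generic_family_on {K V κ ι : Type*} [Field K] [Fintype K]
    [AddCommGroup V] [Module K V] [FiniteDimensional K V] [Fintype κ] [Fintype ι]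
    (U : κ → Submodule K V) (hcard : Fintype.card (κ × Finset ι) < Fintype.card K)
    (s : Finset ι) :
    ∃ v : ι → V, ∀ k, ∀ R ⊆ s, finrank K ↥(U k ⊔ Submodule.span K (v '' (R : Set ι))) =
      min (finrank K V) (finrank K (U k) + R.card) := by
  classical
  induction s using Finset.induction_on with
  | empty =>
    refine ⟨0, fun k R hR => ?_⟩
    obtain rfl := Finset.subset_empty.1 hR
    rw [Finset.coe_empty, Set.image_empty, Submodule.span_empty, sup_bot_eq, Finset.card_empty,
      add_zero, min_eq_right (Submodule.finrank_le (U k))]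
  | insert x s hx ih =>
    obtain ⟨v, hv⟩ := ih
    obtain ⟨w, hw⟩ := Submodule.exists_forall_notMem_of_card_lt
      (fun q : κ × Finset ι => U q.1 ⊔ Submodule.span K (v '' (q.2 : Set ι))) hcard
    refine ⟨Function.update v x w, fun k R hR => ?_⟩
    have himage : ∀ R : Finset ι, x ∉ R →
        Function.update v x w '' (R : Set ι) = v '' (R : Set ι) := fun R hxR =>
      Set.image_congr fun y hy => Function.update_of_ne (by rintro rfl; exact hxR hy) _ _
    by_cases hxR : x ∈ R
    · have hR' : R.erase x ⊆ s := by
        rw [← Finset.erase_insert hx]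
        exact Finset.erase_subset_erase x hR
      have hdim := hv k _ hR'
      have hspan : U k ⊔ Submodule.span K (Function.update v x w '' (R : Set ι)) =
          (U k ⊔ Submodule.span K (v '' (R.erase x : Finset ι))) ⊔ Submodule.span K {w} := by
        conv_lhs => rw [← Finset.insert_erase hxR]
        rw [Finset.coe_insert, Set.image_insert_eq, Function.update_self,
          himage _ (Finset.notMem_erase x R), Submodule.span_insert, sup_comm (Submodule.span K {w}),
          sup_assoc]
      have hRc := Finset.card_erase_add_one hxR
      rw [hspan]
      by_cases htop : U k ⊔ Submodule.span K (v '' (R.erase x : Finset ι)) = ⊤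
      · rw [htop, finrank_top] at hdim
        rw [htop, top_sup_eq, finrank_top]
        omega
      · have hlt := Submodule.finrank_lt htop
        rw [Submodule.finrank_sup_span_singleton (hw (k, R.erase x) htop), hdim]
        omega
    · rw [himage R hxR]
      exact hv k R ((Finset.subset_insert_iff_of_notMem hxR).1 hR)

open Module in
/-- Over a large finite field there are vectors in general position with respect to finitely many
given subspaces. -/
theorem exists_generic_family {K V κ ι : Type*} [Field K] [Fintype K]
    [AddCommGroup V] [Module K V] [FiniteDimensional K V] [Fintype κ] [Fintype ι]
    (U : κ → Submodule K V) (hcard : Fintype.card (κ × Finset ι) < Fintype.card K) :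
    ∃ v : ι → V, ∀ k, ∀ R : Finset ι,
      finrank K ↥(U k ⊔ Submodule.span K (v '' (R : Set ι))) =
        min (finrank K V) (finrank K (U k) + R.card) := by
  obtain ⟨v, hv⟩ := exists_generic_family_on U hcard Finset.univ
  exact ⟨v, fun k R => hv k R (Finset.subset_univ R)⟩

/-- A set of coefficient vectors spans if and only if it determines every vector. -/
theorem span_eq_top_iff_forall_dotProduct_eq_zero {K ι : Type*} [Field K] [Fintype ι]
    (S : Set (ι → K)) :
    Submodule.span K S = ⊤ ↔ ∀ d : ι → K, (∀ s ∈ S, s ⬝ᵥ d = 0) → d = 0 := by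
  classical
  constructor
  · intro h d hd
    have hall : ∀ w : ι → K, w ⬝ᵥ d = 0 := fun w => by
      have hw : w ∈ Submodule.span K S := h ▸ Submodule.mem_top
      induction hw using Submodule.span_induction with
      | mem s hs => exact hd s hs
      | zero => exact zero_dotProduct d
      | add x y _ _ hx hy => rw [add_dotProduct, hx, hy, add_zero]
      | smul r x _ hx => rw [smul_dotProduct, hx, smul_zero]
    funext j
    simpa using hall (Pi.single j 1)
  · intro h
    by_contra htop
    obtain ⟨f, hf0, hf⟩ := Submodule.exists_le_ker_of_lt_top _ (lt_top_iff_ne_top.2 htop)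
    have hfd : ∀ w : ι → K, f w = w ⬝ᵥ fun j => f (Pi.single j 1) := fun w => by
      conv_lhs => rw [pi_eq_sum_univ' w]
      simp [dotProduct]
    have hd := h (fun j => f (Pi.single j 1)) fun s hs => by
      rw [← hfd]
      exact hf (Submodule.subset_span hs)
    refine hf0 (LinearMap.ext fun w => ?_)
    rw [hfd, hd, dotProduct_zero, LinearMap.zero_apply]

/-! ### Reed-Solomon codes and Vandermonde checksums. -/

/-- A systematic Reed-Solomon code. -/
theorem exists_systematic_isMDSGenerator {K : Type*} [Field K] {k n : ℕ} (hkn : k ≤ n)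
    (α : Fin n ↪ K) :
    ∃ G : Matrix (Fin k) (Fin n) K, IsMDSGenerator G ∧
      ∀ (s : Fin k) (j : Fin n), (j : ℕ) < k → G s j = if (s : ℕ) = j then 1 else 0 := by
  classical
  let x : Fin k → K := fun s => α (Fin.castLE hkn s)
  have hx : Set.InjOn x (Finset.univ : Finset (Fin k)) := fun s _ t _ h =>
    Fin.castLE_injective hkn (α.injective h)
  -- The codeword of `u` lists the values of the polynomial of degree below `k` that interpolates
  -- `u` at the first `k` points; it has fewer than `k` zeros.
  refine ⟨Matrix.of fun s j => (Lagrange.basis Finset.univ x s).eval (α j), ?_, ?_⟩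
  · intro u hu
    let p := Lagrange.interpolate Finset.univ x u
    have hev : ∀ j, Matrix.vecMul u
        (Matrix.of fun s j => (Lagrange.basis Finset.univ x s).eval (α j)) j = p.eval (α j) := by
      intro j
      simp [p, Lagrange.interpolate_apply, Matrix.vecMul, dotProduct, Polynomial.eval_finsetSum]
    have hp : p ≠ 0 := by
      rintro hp
      refine hu (funext fun s => ?_)
      rw [← Lagrange.eval_interpolate_at_node u hx (Finset.mem_univ s), show
        Lagrange.interpolate Finset.univ x u = 0 from hp, Polynomial.eval_zero, Pi.zero_apply]
    have hdeg : p.natDegree < k := by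
      have := Lagrange.degree_interpolate_lt u hx
      rw [Finset.card_univ, Fintype.card_fin] at this
      exact (Polynomial.natDegree_lt_iff_degree_lt hp).2 this
    have hroots : (Finset.univ.filter fun j => p.eval (α j) = 0).card ≤ p.natDegree := by
      refine le_trans ?_ (Polynomial.card_roots' p)
      rw [← Finset.card_map α]
      refine le_trans (Finset.card_le_card fun y hy => ?_) (Multiset.toFinset_card_le p.roots)
      obtain ⟨j, hj, rfl⟩ := Finset.mem_map.1 hy
      rw [Multiset.mem_toFinset, Polynomial.mem_roots hp]
      exact (Finset.mem_filter.1 hj).2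
    have hsplit := Finset.card_filter_add_card_filter_not (s := (Finset.univ : Finset (Fin n)))
      (fun j => p.eval (α j) = 0)
    rw [Finset.card_univ, Fintype.card_fin] at hsplit
    simp only [hammingNorm, hev]
    have hcongr : (Finset.univ.filter fun j => p.eval (α j) ≠ 0).card =
      (Finset.univ.filter fun j => ¬ p.eval (α j) = 0).card := rfl
    convert (show n + 1 ≤ k + (Finset.univ.filter fun j => p.eval (α j) ≠ 0).card by omega)
  · intro s j hj
    have hαj : α j = x ⟨j, hj⟩ := rfl
    simp only [Matrix.of_apply, hαj]
    split_ifs with h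
    · obtain rfl : s = ⟨j, hj⟩ := Fin.ext h
      exact Lagrange.eval_basis_self hx (Finset.mem_univ _)
    · exact Lagrange.eval_basis_of_ne (fun h' => h (congrArg Fin.val h')) (Finset.mem_univ _)

/-- A vector with at most `k` nonzero entries whose first `k` power sums vanish is zero. -/
theorem eq_zero_of_forall_sum_mul_pow_eq_zero {K ι : Type*} [Field K] [Fintype ι]
    (α : ι ↪ K) {k : ℕ} (v : ι → K) (W : Finset ι) (hW : W.card ≤ k) (hv : ∀ j ∉ W, v j = 0)
    (h : ∀ s < k, ∑ j, v j * α j ^ s = 0) : v = 0 := by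
  classical
  funext x
  by_cases hx : x ∈ W
  swap
  · exact hv x hx
  -- `p` has degree below `k` and vanishes at all points of `W` except `x`; pairing it with `v`
  -- isolates `v x`.
  let p : Polynomial K := ∏ j ∈ W.erase x, (Polynomial.X - Polynomial.C (α j))
  have hdeg : p.natDegree < k := by
    rw [Polynomial.natDegree_prod_of_monic _ _ fun j _ => Polynomial.monic_X_sub_C _]
    have := Finset.card_erase_add_one hx
    simp only [Polynomial.natDegree_X_sub_C, Finset.sum_const, smul_eq_mul, mul_one]
    omega
  have h0 : ∑ j, v j * p.eval (α j) = 0 := by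
    simp_rw [Polynomial.eval_eq_sum_range' hdeg, Finset.mul_sum]
    rw [Finset.sum_comm]
    refine Finset.sum_eq_zero fun s hs => ?_
    rw [← mul_zero (p.coeff s), ← h s (Finset.mem_range.1 hs), Finset.mul_sum]
    exact Finset.sum_congr rfl fun j _ => by ring
  rw [Finset.sum_eq_single x] at h0
  · refine (mul_eq_zero.1 h0).resolve_right ?_
    rw [Polynomial.eval_prod]
    refine Finset.prod_ne_zero_iff.2 fun j hj => ?_
    simpa [sub_eq_zero] using fun h' => Finset.ne_of_mem_erase hj h'.symm
  · intro j _ hj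
    by_cases hjW : j ∈ W
    · rw [Polynomial.eval_prod, Finset.prod_eq_zero (Finset.mem_erase.2 ⟨hj, hjW⟩) (by simp),
        mul_zero]
    · rw [hv j hjW, zero_mul]
  · simp

theorem Link.exists_col_eq {n m k : ℕ} (hk : k < n + m) : ∃ t : Link n m, t.col = k := by
  by_cases h : k < n
  · exact ⟨Sum.inl ⟨k, h⟩, rfl⟩
  · exact ⟨Sum.inr ⟨k - n, by omega⟩, by simp only [Link.col]; omega⟩

/-! ### Which symbols determine the message. -/

namespace ZigZagCode

variable {K : Type*} [Field K] {n m a c z : ℕ}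

theorem xVec_dotProduct (C : ZigZagCode K n m a c z) (l : Fin (a - c)) (j : Fin n) (μ : C.Msg) :
    C.xVec (l, j) ⬝ᵥ μ = Matrix.vecMul (fun s => μ (Sum.inl ⟨l, s⟩)) (C.G l) j := by
  rw [dotProduct, Fintype.sum_sum_type, Fintype.sum_sigma, Finset.sum_eq_single l]
  · simp [xVec, Matrix.vecMul, dotProduct, mul_comm]
  · intro l' _ hl'
    simp [xVec, hl']
  · simp

theorem yVec_dotProduct (C : ZigZagCode K n m a c z) (p : Fin c × Fin (n + m - 2 * z))
    (μ : C.Msg) : C.yVec p ⬝ᵥ μ = μ (Sum.inr p) := by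
  rw [yVec, single_one_dotProduct]

theorem card_msgIdx (C : ZigZagCode K n m a c z) :
    Fintype.card C.MsgIdx = (a - c) * (n - z) + ∑ l, C.k' l + c * (n + m - 2 * z) := by
  simp [Finset.sum_add_distrib]

/-- A message is determined by its upstream symbols off one link and by the lower symbols off
`2 * z - 1` links, provided that at most `c` rows of `X` carry no redundant symbol. -/
theorem eq_zero_of_symbols_eq_zero (C : ZigZagCode K n m a c z) (hzn : z ≤ n)
    (hnm : 2 * z ≤ n + m) (hmds : ∀ l, IsMDSGenerator (C.G l)) (hgen : C.IsGeneric)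
    (hk : ∀ l, C.k' l ≤ z) (hc : (Finset.univ.filter fun l => C.k' l = z).card ≤ c)
    (i : Fin n) (B : Finset (Link n m)) (hB : B.card + 1 ≤ 2 * z) (d : C.Msg)
    (hX : ∀ l j, j ≠ i → C.xVec (l, j) ⬝ᵥ d = 0)
    (hL : ∀ r t, t ∉ B → C.lowerVec r t ⬝ᵥ d = 0) : d = 0 := by
  classical
  let badY : Finset (Fin (n + m - 2 * z)) := Finset.univ.filter fun j => ∃ t ∈ B, t.col = j
  let badL : Finset (Fin (2 * z)) :=
    Finset.univ.filter fun s => ∃ t ∈ B, t.col = n + m - 2 * z + s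
  -- Each link carries a single column, which lies either in `Y` or in `L`.
  have hbad : badY.card + badL.card ≤ B.card := by
    have hinj : Function.Injective fun s : Fin (2 * z) => n + m - 2 * z + (s : ℕ) :=
      fun s t h => Fin.ext (Nat.add_left_cancel h)
    rw [← Finset.card_image_of_injective badY Fin.val_injective,
      ← Finset.card_image_of_injective badL hinj, ← Finset.card_union_of_disjoint]
    · refine le_trans (Finset.card_le_card ?_) (Finset.card_image_le (s := B) (f := Link.col))
      intro x hx
      rw [Finset.mem_image]
      rcases Finset.mem_union.1 hx with hx | hx <;> obtain ⟨y, hy, rfl⟩ := Finset.mem_image.1 hx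
      · exact (Finset.mem_filter.1 hy).2
      · exact (Finset.mem_filter.1 hy).2
    · rw [Finset.disjoint_left]
      intro x hx hx'
      obtain ⟨y, -, rfl⟩ := Finset.mem_image.1 hx
      obtain ⟨s, -, hs⟩ := Finset.mem_image.1 hx'
      have := y.2
      omega
  let P : Set (Fin (a - c) × Fin n) := {p | p.2 ≠ i}
  let Q : Set (Fin c × Fin (n + m - 2 * z)) := {p | p.2 ∉ badY}
  let R : Finset (Fin c × Fin (2 * z)) := Finset.univ ×ˢ badLᶜ
  -- `E` completes the known entries of `X` and `Y` to a spanning set. As it is no larger than the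
  -- set `R` of known entries of `L`, genericity lets `R` replace it.
  let E : Finset (C.MsgIdx → K) :=
    (Finset.univ.filter fun l => C.k' l = z).image (fun l => C.xVec (l, i)) ∪
      ((Finset.univ : Finset (Fin c)) ×ˢ badY).image C.yVec
  have hRcard : R.card = c * (2 * z - badL.card) := by
    simp [R, Finset.card_product, Finset.card_compl]
  have hEcard : E.card ≤ c + c * badY.card := by
    refine (Finset.card_union_le _ _).trans (add_le_add (Finset.card_image_le.trans hc) ?_)
    refine Finset.card_image_le.trans ?_
    simp
  have hER : E.card ≤ R.card := by
    have h1 : badY.card + 1 ≤ 2 * z - badL.card := by omega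
    have h2 := Nat.mul_le_mul_left c h1
    rw [hRcard]
    linarith
  have hspanE : Submodule.span K ((C.xVec '' P ∪ C.yVec '' Q) ∪ (E : Set (C.MsgIdx → K))) = ⊤ := by
    rw [span_eq_top_iff_forall_dotProduct_eq_zero]
    intro u hu
    have hur : ∀ l, (fun s => u (Sum.inl ⟨l, s⟩)) = 0 := by
      intro l
      by_contra hne
      have hw := hmds l _ hne
      have hz : ∀ j, j ≠ i → Matrix.vecMul (fun s => u (Sum.inl ⟨l, s⟩)) (C.G l) j = 0 := by
        intro j hj
        rw [← xVec_dotProduct]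
        exact hu _ (Or.inl (Or.inl ⟨(l, j), hj, rfl⟩))
      -- With `k' l = z` the code has full length as dimension, so the entry at `i` is needed;
      -- otherwise the distance is at least 2 and one erasure is harmless.
      by_cases hl : C.k' l = z
      · have hzi : Matrix.vecMul (fun s => u (Sum.inl ⟨l, s⟩)) (C.G l) i = 0 := by
          rw [← xVec_dotProduct]
          refine hu _ (Or.inr ?_)
          simp only [E, Finset.coe_union, Finset.coe_image]
          exact Or.inl ⟨l, by simpa using hl, rfl⟩
        have h0 : Matrix.vecMul (fun s => u (Sum.inl ⟨l, s⟩)) (C.G l) = 0 := by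
          funext j
          by_cases hj : j = i
          · rw [hj, hzi, Pi.zero_apply]
          · exact hz j hj
        rw [h0, hammingNorm_zero] at hw
        omega
      · have hlt := lt_of_le_of_ne (hk l) hl
        have hone : hammingNorm (Matrix.vecMul (fun s => u (Sum.inl ⟨l, s⟩)) (C.G l)) ≤ 1 := by
          rw [hammingNorm, ← Finset.card_singleton i]
          refine Finset.card_le_card fun j hj => ?_
          rw [Finset.mem_singleton]
          by_contra hji
          exact (Finset.mem_filter.1 hj).2 (hz j hji)
        have hone' := hw.trans (Nat.add_le_add_left
          (show _ ≤ 1 by convert hone) _)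
        omega
    funext q
    rcases q with ⟨l, s⟩ | p
    · exact congrFun (hur l) s
    · rw [← yVec_dotProduct C p u, Pi.zero_apply]
      by_cases hp : p.2 ∈ badY
      · refine hu _ (Or.inr ?_)
        simp only [E, Finset.coe_union, Finset.coe_image]
        exact Or.inr ⟨p, by simpa using hp, rfl⟩
      · exact hu _ (Or.inl (Or.inr ⟨p, hp, rfl⟩))
  have hdim : Fintype.card C.MsgIdx ≤
      Module.finrank K (Submodule.span K (C.xVec '' P ∪ C.yVec '' Q)) + E.card := by
    rw [← Module.finrank_fintype_fun_eq_card K, ← finrank_top K (C.MsgIdx → K), ← hspanE,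
      Submodule.span_union]
    exact (Submodule.finrank_add_le_finrank_add_finrank _ _).trans
      (Nat.add_le_add_left (finrank_span_finset_le_card E) _)
  have htop : Submodule.span K (C.xVec '' P ∪ C.yVec '' Q ∪
      (fun s => C.L s.1 s.2) '' (R : Set (Fin c × Fin (2 * z)))) = ⊤ := by
    refine Submodule.eq_top_of_finrank_eq ?_
    rw [hgen P Q R, Module.finrank_fintype_fun_eq_card, min_eq_left (by omega)]
  refine (span_eq_top_iff_forall_dotProduct_eq_zero _).1 htop d ?_
  rintro v ((⟨⟨l, j⟩, hj, rfl⟩ | ⟨⟨r, j⟩, hj, rfl⟩) | ⟨⟨r, s⟩, hs, rfl⟩)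
  · exact hX l j hj
  · obtain ⟨t, ht⟩ := Link.exists_col_eq (n := n) (m := m) (k := j) (by have := j.2; omega)
    have h := hL r t fun htB => hj (Finset.mem_filter.2 ⟨Finset.mem_univ _, t, htB, ht⟩)
    have hcol : t.col < n + m - 2 * z := ht ▸ j.2
    rw [lowerVec, dif_pos hcol] at h
    rwa [show (⟨t.col, hcol⟩ : Fin (n + m - 2 * z)) = j from Fin.ext ht] at h
  · obtain ⟨t, ht⟩ := Link.exists_col_eq (n := n) (m := m) (k := n + m - 2 * z + s)
      (by have := s.2; omega)
    have hs' : s ∉ badL := by simpa [R] using hs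
    have h := hL r t fun htB => hs' (Finset.mem_filter.2 ⟨Finset.mem_univ _, t, htB, ht⟩)
    rw [lowerVec, dif_neg (by omega)] at h
    convert h
    simp only [ht]
    omega

/-! ### Existence of the code. -/

/-- Over a large finite field there is a code of the encoding scheme whose numbers of feedback
symbols per row are prescribed. -/
theorem exists_code [Fintype K] (hzn : z ≤ n) (k' : Fin (a - c) → ℕ) (hk : ∀ l, k' l ≤ z)
    (α : Fin n ↪ K)
    (hcard : Fintype.card ((Set (Fin (a - c) × Fin n) × Set (Fin c × Fin (n + m - 2 * z))) ×
      Finset (Fin c × Fin (2 * z))) < Fintype.card K) :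
    ∃ C : ZigZagCode K n m a c z, C.k' = k' ∧ C.IsGeneric ∧ (∀ l, IsMDSGenerator (C.G l)) ∧
      ∀ (l : Fin (a - c)) (s : Fin (n - z + C.k' l)) (j : Fin n),
        (j : ℕ) < n - z + C.k' l → C.G l s j = if (s : ℕ) = j then 1 else 0 := by
  choose G hG hsys using fun l : Fin (a - c) =>
    exists_systematic_isMDSGenerator (k := n - z + k' l) (by have := hk l; omega) α
  let C₀ : ZigZagCode K n m a c z := ⟨k', G, fun _ _ => 0⟩
  obtain ⟨v, hv⟩ := exists_generic_family
    (fun q : Set (Fin (a - c) × Fin n) × Set (Fin c × Fin (n + m - 2 * z)) =>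
      Submodule.span K (C₀.xVec '' q.1 ∪ C₀.yVec '' q.2)) hcard
  let C : ZigZagCode K n m a c z := ⟨k', G, fun r s => v (r, s)⟩
  have hx : C.xVec = C₀.xVec := by
    funext p q
    rcases q with q | q <;> rfl
  have hy : C.yVec = C₀.yVec := rfl
  refine ⟨C, rfl, fun P Q R => ?_, hG, hsys⟩
  have h := hv (P, Q) R
  rw [hx, hy]
  rw [Module.finrank_fintype_fun_eq_card, ← Submodule.span_union] at h
  exact h

/-! ### Signaling and exhaustive search. -/

open Classical in
/-- The signaling strategy that ignores the link `i`: node `B` compares Vandermonde checksums of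
the rows of `X`, and node `A` checks that the rows without feedback symbols are codewords. -/
noncomputable def erasureSignaling (C : ZigZagCode K n m a c z) (α : Fin n ↪ K) (i : Fin n) :
    C.Signaling where
  θ _ := Matrix.of fun j s => if j = i then 0 else α j ^ (s : ℕ)
  signalA X := ∃ l, C.k' l = 0 ∧ ¬ ∃ u, ∀ j, j ≠ i → X l j = Matrix.vecMul u (C.G l) j
  detectB μ f := ∃ l, f l ≠ Matrix.vecMul ((C.encode μ).1 l)
    (Matrix.of fun j (s : Fin (C.k' l)) => if j = i then 0 else α j ^ (s : ℕ))

theorem not_claims_erasureSignaling (C : ZigZagCode K n m a c z) (α : Fin n ↪ K) (i : Fin n)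
    (μ : C.Msg) (X : Matrix (Fin (a - c)) (Fin n) K)
    (hX : ∀ l j, j ≠ i → X l j = (C.encode μ).1 l j) :
    ¬ (C.erasureSignaling α i).Claims μ X := by
  rintro (⟨l, -, hl⟩ | ⟨l, hl⟩)
  · exact hl ⟨_, fun j hj => (hX l j hj).trans (C.xVec_dotProduct l j μ)⟩
  · refine hl (funext fun s => ?_)
    simp only [Signaling.feedback, erasureSignaling, Matrix.vecMul, dotProduct, Matrix.of_apply]
    refine Finset.sum_congr rfl fun j _ => ?_
    by_cases hj : j = i
    · simp [hj]
    · rw [hX l j hj]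

theorem error_eq_zero_of_not_claims (C : ZigZagCode K n m a c z) (hzn : z ≤ n)
    (hmds : ∀ l, IsMDSGenerator (C.G l)) (hk : ∀ l, C.k' l = 0 ∨ z - 1 ≤ C.k' l)
    (α : Fin n ↪ K) (i : Fin n) (μ : C.Msg) (Z : Finset (Link n m)) (e : C.Word)
    (hi : Sum.inl i ∈ Z) (hZ : Z.card ≤ z) (he : C.SupportedOn e Z)
    (hclaim : ¬ (C.erasureSignaling α i).Claims μ (C.encode μ + e).1)
    (l : Fin (a - c)) (j : Fin n) (hj : j ≠ i) : e.1 l j = 0 := by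
  classical
  obtain ⟨hA, hB⟩ := not_or.1 hclaim
  have hup : ∀ S : Finset (Link n m), (Finset.univ.filter fun j => Sum.inl j ∈ S).card ≤ S.card := by
    intro S
    rw [← Finset.card_image_of_injective _ (Sum.inl_injective (α := Fin n) (β := Fin m))]
    refine Finset.card_le_card fun t ht => ?_
    obtain ⟨j, hj, rfl⟩ := Finset.mem_image.1 ht
    exact (Finset.mem_filter.1 hj).2
  rcases hk l with hl | hl
  · have hu : ∃ u, ∀ j, j ≠ i → (C.encode μ + e).1 l j = Matrix.vecMul u (C.G l) j := by
      by_contra h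
      exact hA ⟨l, hl, h⟩
    obtain ⟨u, hu⟩ := hu
    have hw : ∀ j, j ≠ i →
        Matrix.vecMul (u - fun s => μ (Sum.inl ⟨l, s⟩)) (C.G l) j = e.1 l j := by
      intro j hj
      rw [Matrix.sub_vecMul, Pi.sub_apply, ← hu j hj, ← xVec_dotProduct]
      exact add_sub_cancel_left _ _
    rw [← hw j hj]
    by_cases h0 : (u - fun s => μ (Sum.inl ⟨l, s⟩)) = 0
    · rw [h0, Matrix.zero_vecMul, Pi.zero_apply]
    · have hwt := hmds l _ h0
      have hle : hammingNorm (Matrix.vecMul (u - fun s => μ (Sum.inl ⟨l, s⟩)) (C.G l)) ≤ z := by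
        refine (Finset.card_le_card fun j hj => ?_).trans ((hup Z).trans hZ)
        rw [Finset.mem_filter]
        refine ⟨Finset.mem_univ j, ?_⟩
        by_contra hjZ
        refine (Finset.mem_filter.1 hj).2 ?_
        -- The difference of codewords is uncontrolled at `i`, but `i ∈ Z`, so that position is
        -- already among the `z` counted.
        rw [hw j (by rintro rfl; exact hjZ hi)]
        exact he.1 l j hjZ
      have hle' := hwt.trans (Nat.add_le_add_left (show _ ≤ z by convert hle) _)
      omega
  · have hfb : (C.erasureSignaling α i).feedback (C.encode μ + e).1 l =
        Matrix.vecMul ((C.encode μ).1 l) ((C.erasureSignaling α i).θ l) := by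
      by_contra h
      exact hB ⟨l, h⟩
    -- The zero weight at `i` removes one error from the count, which is why `z - 1` checksums are
    -- enough.
    have hv := eq_zero_of_forall_sum_mul_pow_eq_zero α (k := C.k' l)
      (fun j => if j = i then 0 else e.1 l j)
      (Finset.univ.filter fun j => Sum.inl j ∈ Z.erase (Sum.inl i))
      ((hup _).trans (by rw [Finset.card_erase_of_mem hi]; omega))
      (fun j hjZ => by
        by_cases hji : j = i
        · simp [hji]
        · simp only [hji, if_false]
          refine he.1 l j fun hmem => hjZ ?_
          simp [hji, hmem])
      (fun s hs => by
        have h := congrFun hfb ⟨s, hs⟩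
        have hadd : ((C.encode μ + e).1 : Matrix (Fin (a - c)) (Fin n) K) l =
          (C.encode μ).1 l + e.1 l := rfl
        rw [Signaling.feedback, hadd, Matrix.add_vecMul, Pi.add_apply, add_eq_left] at h
        refine Eq.trans ?_ h
        simp only [Matrix.vecMul, dotProduct, erasureSignaling, Matrix.of_apply]
        refine Finset.sum_congr rfl fun j _ => ?_
        by_cases hji : j = i <;> simp [hji])
    simpa [hj] using congrFun hv j

theorem searchDecode_eq_some (C : ZigZagCode K n m a c z) (i : Fin n)
    (T : Set (Fin (a - c) × Fin n)) (o : List (Finset (Link n m))) (w : C.Word) (μ : C.Msg)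
    (huniq : ∀ R ∈ o, ∀ ν, C.ConsistentWith i T w R ν → ν = μ)
    (hex : ∃ R ∈ o, C.ConsistentWith i T w R μ) : C.searchDecode i T o w = some μ := by
  classical
  cases h : C.searchDecode i T o w with
  | none =>
    obtain ⟨R, hR, hcons⟩ := hex
    have hnone := List.findSome?_eq_none_iff.1 h R hR
    rw [dif_pos ⟨μ, hcons⟩] at hnone
    exact absurd hnone (Option.some_ne_none _)
  | some ν =>
    obtain ⟨R, hR, hν⟩ := List.exists_of_findSome?_eq_some h
    split_ifs at hν with hc
    rw [← Option.some.inj hν, huniq R hR _ hc.choose_spec]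

end ZigZagCode

/-! ### Consequences of the tight conditions. -/

/-- Here `h` is the number of rows with `k' = z`: together with the `z - 1` symbols of the last row
they use up `b = z * h + (z - 1)`. In the first case `h = a - c - 1`; in the second `h = (b - 1) /
2`, and the tight bound reads `b < 2 * c`. -/
theorem TightConditions.bounds {n m a c b z : ℕ} (hca : c < a)
    (htight : TightConditions n m a c b z)
    (hb : (b + 1 = z * (a - c) ∧ 2 < z) ∨ (Odd b ∧ b + 1 < z * (a - c) ∧ z = 2)) :
    z ≤ n ∧ 2 * z ≤ n + m ∧ ∃ h, b + 1 = z * (h + 1) ∧ h < a - c ∧ h ≤ c := by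
  obtain ⟨D, rfl⟩ : ∃ D, a = c + (D + 1) := ⟨a - c - 1, by omega⟩
  simp only [Nat.add_sub_cancel_left] at hb ⊢
  have hz : 2 ≤ z := by omega
  unfold TightConditions at htight
  push_cast at htight
  simp only [lt_min_iff] at htight
  have hn : z ≤ n := by omega
  have hm : z < m := by
    rcases htight with h | h | ⟨-, -, -, h⟩ | ⟨-, -, -, -, h⟩
    · omega
    · omega
    all_goals
      by_contra hm
      have : (m : ℤ) - z ≤ 0 := by omega
      nlinarith
  refine ⟨hn, by omega, ?_⟩
  rcases hb with ⟨hb, hz3⟩ | ⟨⟨k, rfl⟩, hb, rfl⟩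
  · refine ⟨D, hb, by omega, ?_⟩
    zify at hb hz3 hn ⊢
    rcases htight with ⟨-, -, -, h⟩ | ⟨-, -, -, -, h⟩ | ⟨-, h0, -, h⟩ | ⟨-, -, h0, -, h⟩
    · nlinarith
    · nlinarith
    -- For `m < 2 * z` the case is void: `b < (m - z) * (a - c) ≤ (z - 1) * (a - c)` contradicts `b
    -- + 1 = z * (a - c)`.
    all_goals
      have : (m : ℤ) - z ≤ z - 1 := by omega
      nlinarith
  · refine ⟨k, by omega, by omega, ?_⟩
    push_cast at htight
    rcases htight with ⟨-, -, -, h⟩ | ⟨-, h, -⟩ | ⟨-, -, h, -⟩ | ⟨-, h, -⟩ <;> grind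

/-! ### Assembly. -/

theorem theorem2 (n m a c b z : ℕ) (hca : c < a) (hba : b < a)
    (htight : TightConditions n m a c b z)
    (hb : (b + 1 = z * (a - c) ∧ 2 < z) ∨ (Odd b ∧ b + 1 < z * (a - c) ∧ z = 2)) :
    ∃ q₀ : ℕ, ∀ (K : Type*) [Field K] [Fintype K], q₀ ≤ Fintype.card K →
      ∃ C : ZigZagCode K n m a c z, C.IsAdmissible b ∧
        (Fintype.card C.MsgIdx : ℤ) = ((n : ℤ) - z) * a + ((m : ℤ) - z) * c + b ∧
        -- `i` is the identified upstream link
        ∀ i : Fin n, ∃ (S : C.Signaling) (T : Set (Fin (a - c) × Fin n)),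
          C.core i ⊆ T ∧
          -- no claim is sent unless there is a new error on the upstream links
          (∀ (μ : C.Msg) (X : Matrix (Fin (a - c)) (Fin n) K),
            (∀ l j, j ≠ i → X l j = (C.encode μ).1 l j) → ¬ S.Claims μ X) ∧
          -- whenever no claim is sent, the sink decodes correctly
          ∀ (μ : C.Msg) (Z : Finset (Link n m)) (e : C.Word),
            Sum.inl i ∈ Z → Z.card ≤ z → C.SupportedOn e Z →
            ¬ S.Claims μ (C.encode μ + e).1 →
              (∀ (R : Finset (Link n m)) (ν : C.Msg), ZigZagCode.IsRemovalSet z i R →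
                C.ConsistentWith i T (C.encode μ + e) R ν → ν = μ) ∧
              (∀ o : List (Finset (Link n m)),
                (∀ R, R ∈ o ↔ ZigZagCode.IsRemovalSet z i R) →
                C.searchDecode i T o (C.encode μ + e) = some μ) := by
  classical
  obtain ⟨hzn, hnm, h, hbh, hh, hhc⟩ := htight.bounds hca hb
  have hz : 2 ≤ z := by omega
  -- The summand `n` provides distinct evaluation points, the cardinality the general position of
  -- `L`.
  refine ⟨n + Fintype.card ((Set (Fin (a - c) × Fin n) × Set (Fin c × Fin (n + m - 2 * z))) ×
    Finset (Fin c × Fin (2 * z))) + 1, fun K _ _ hq => ?_⟩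
  obtain ⟨α⟩ : Nonempty (Fin n ↪ K) :=
    Function.Embedding.nonempty_of_card_le (by rw [Fintype.card_fin]; omega)
  let k' : Fin (a - c) → ℕ := fun l =>
    if (l : ℕ) + 1 = a - c then z - 1 else if (l : ℕ) < h then z else 0
  have hk'z : ∀ l, k' l = z ↔ (l : ℕ) < h := by
    intro l
    simp only [k']
    split_ifs <;> omega
  have hk'le : ∀ l, k' l ≤ z := by
    intro l
    simp only [k']
    split_ifs <;> omega
  have hsum : ∑ l, k' l = b := by
    obtain ⟨D, hD⟩ : ∃ D, a - c = D + 1 := ⟨a - c - 1, by omega⟩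
    have h1 : ∑ l, k' l = ∑ x ∈ Finset.range (D + 1),
        if x + 1 = a - c then z - 1 else if x < h then z else 0 := by
      rw [← hD, Finset.sum_range]
    rw [h1, Finset.sum_range_succ, if_pos hD.symm, Finset.sum_congr rfl fun x hx =>
      if_neg (show ¬ x + 1 = a - c by have := Finset.mem_range.1 hx; omega), ← Finset.sum_filter,
      Finset.sum_const, show (Finset.range D).filter (· < h) = Finset.range h by
        ext x
        simp only [Finset.mem_filter, Finset.mem_range]
        omega, Finset.card_range, smul_eq_mul]
    rw [mul_add, mul_one, mul_comm] at hbh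
    omega
  obtain ⟨C, hCk, hgen, hmds, hsys⟩ :=
    ZigZagCode.exists_code (K := K) (m := m) hzn k' hk'le α (by omega)
  have hkc : (Finset.univ.filter fun l => C.k' l = z).card ≤ c := by
    simp only [hCk, hk'z]
    refine le_trans ?_ hhc
    rw [← Finset.card_image_of_injective _ Fin.val_injective]
    conv_rhs => rw [← Finset.card_range h]
    refine Finset.card_le_card fun x hx => ?_
    obtain ⟨l, hl, rfl⟩ := Finset.mem_image.1 hx
    exact Finset.mem_range.2 (Finset.mem_filter.1 hl).2
  refine ⟨C, ⟨by rw [hCk, hsum], fun l hl => ?_, fun l hl => ?_, hsys, hmds, hgen⟩, ?_, fun i => ?_⟩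
  · rw [hCk]
    simp only [k', if_pos hl]
  · rw [hCk]
    simp only [k']
    split_ifs <;> omega
  · rw [C.card_msgIdx, hCk, hsum]
    push_cast [Nat.cast_sub hca.le, Nat.cast_sub hzn, Nat.cast_sub hnm]
    ring
  refine ⟨C.erasureSignaling α i, {p | p.2 ≠ i}, fun p hp => hp.1,
    C.not_claims_erasureSignaling α i, fun μ Z e hi hZ he hclaim => ?_⟩
  have he0 := C.error_eq_zero_of_not_claims hzn hmds (fun l => by
    rw [hCk]
    simp only [k']
    split_ifs <;> omega) α i μ Z e hi hZ he hclaim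
  have huniq : ∀ (R : Finset (Link n m)) (ν : C.Msg), ZigZagCode.IsRemovalSet z i R →
      C.ConsistentWith i {p | p.2 ≠ i} (C.encode μ + e) R ν → ν = μ := by
    rintro R ν ⟨-, hR⟩ ⟨hT, -, hlow⟩
    refine sub_eq_zero.1 (C.eq_zero_of_symbols_eq_zero hzn hnm hmds hgen
      (fun l => hCk ▸ hk'le l) hkc i (Z ∪ R) ?_ (ν - μ) (fun l j hj => ?_) fun r t ht => ?_)
    · have := Finset.card_union_le Z R
      omega
    · have h1 : (C.encode μ).1 l j + e.1 l j = (C.encode ν).1 l j := hT l j hj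
      rw [he0 l j hj, add_zero] at h1
      rw [dotProduct_sub, sub_eq_zero]
      exact h1.symm
    · rw [Finset.mem_union, not_or] at ht
      have h1 : (C.encode μ).2 r t + e.2 r t = (C.encode ν).2 r t :=
        hlow r t (by rintro rfl; exact ht.1 hi) ht.2
      rw [he.2 r t ht.1, add_zero] at h1
      rw [dotProduct_sub, sub_eq_zero]
      exact h1.symm
  refine ⟨huniq, fun o ho => C.searchDecode_eq_some i _ o _ μ
    (fun R hR ν hν => huniq R ν ((ho R).1 hR) hν) ?_⟩
  -- The erroneous links other than `i`, padded to exactly `z - 1` links, form a removal set that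
  -- passes the check with the sent message.
  obtain ⟨R, hZR, hRi, hRc⟩ := Finset.exists_subsuperset_card_eq
    (Finset.erase_subset_erase (Sum.inl i) (Finset.subset_univ Z)) (n := z - 1)
    (by rw [Finset.card_erase_of_mem hi]; omega)
    (by
      rw [Finset.card_erase_of_mem (Finset.mem_univ _), Finset.card_univ, Fintype.card_sum,
        Fintype.card_fin, Fintype.card_fin]
      omega)
  have hadd1 : ∀ l j, e.1 l j = 0 → (C.encode μ + e).1 l j = (C.encode μ).1 l j := fun l j h0 =>
    (congrArg ((C.encode μ).1 l j + ·) h0).trans (add_zero _)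
  refine ⟨R, (ho R).2 ⟨fun hmem => Finset.notMem_erase _ _ (hRi hmem), hRc⟩,
    fun l j hj => hadd1 l j (he0 l j hj), fun l j hj _ => hadd1 l j (he0 l j hj),
    fun r t ht htR => ?_⟩
  exact (congrArg ((C.encode μ).2 r t + ·)
    (he.2 r t fun htZ => htR (hZR (Finset.mem_erase.2 ⟨ht, htZ⟩)))).trans (add_zero _)
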